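/- Let $\Omega\subseteq\mathbb R^n$ be an open set that possesses a Dirichlet heat kernel $K$ (for example a smooth domain). Here a Dirichlet heat kernel is a nonnegative continuous function $K(t,x,y)$ on $(0,\infty)\times\overline\Omega\times\Omega$ such that for every $\varphi\in C_c(\Omega)$ the function $v(0,x)=\varphi(x)$, $v(t,x)=\int_\Omega K(t,x,y)\varphi(y)\,dy$ ($t>0$) is bounded and continuous on $[0,\infty)\times\overline\Omega$, vanishes on $(0,\infty)\times\partial\Omega$, and is a classical solution of $v_t=\Delta v$ in $(0,\infty)\times\Omega$; there is at most one such $K$. For measurable $\varphi\ge 0$ put $S(0)\varphi=\varphi$ and $(S(t)\varphi)(x)=\int_\Omega K(t,x,y)\varphi(y)\,dy$ for $t>0$. Let $f:[0,\infty)\to[0,\infty)$ be continuous and nondecreasing, let $\phi\in L^1_+(\Omega)$ (the a.e. nonnegative integrable functions), and set $$\mathcal F[w](t)=S(t)\phi+\int_0^tS(t-s)f(w(s))\,ds .$$ For $0<T\le\infty$ write $\Omega_T=\Omega\times(0,T)$. A supersolution on $\Omega_T$ is a nonnegative, measurable, almost everywhere finite function $w$ on $\Omega_T$ with $\mathcal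 F[w]\le w$ a.e. in $\Omega_T$. Suppose that there exist $A>1$, $T\in(0,\infty]$, $\psi\in L^1_+(\Omega)$, $g:[0,\infty)\to[0,\infty)$ and a finite-valued function $h\ge 0$ such that for all $t\in(0,T]$ (for all $t\in(0,\infty)$ if $T=\infty$) $$h(t)=\left\|\frac{f(A\,g(S(t)\psi))}{S(t)\psi}\right\|_{L^\infty(\Omega)},\qquad S(t)\phi\le g(S(t)\psi)\ \text{ a.e. in }\Omega,\qquad 1+\left\|\frac{S(t)\psi}{g(S(t)\psi)}\right\|_{L^\infty(\Omega)}\int_0^th(s)\,ds\le A,$$ with the conventions $0/0=0$, $a/0=\infty$ for $a>0$, and $0\cdot\infty=0$. Then $$w(t)=S(t)\phi+S(t)\psi\int_0^th(s)\,ds$$ is a supersolution on $\Omega_T$; moreover $\mathcal F[w](t)\le w(t)$ a.e. in $\Omega$ for every finite $t\in[0,T]$. Thus $T<\infty$ yields local, and $T=\infty$ global, supersolutions. -/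

import Mathlib

open MeasureTheory Set
open scoped NNReal ENNReal Laplacian

/-- `v` is a bounded classical solution of the linear heat equation `v_t = Δ v` in `(0, ∞) × Ω`
with `v = 0` on `(0, ∞) × ∂Ω` and `v(0) = φ`, continuous on `[0, ∞) × closure Ω`. -/
structure IsBoundedHeatSolution {n : ℕ} (Ω : Set (EuclideanSpace ℝ (Fin n)))
    (φ : EuclideanSpace ℝ (Fin n) → ℝ) (v : ℝ → EuclideanSpace ℝ (Fin n) → ℝ) : Prop where
  initial : ∀ x ∈ closure Ω, v 0 x = φ x
  boundary : ∀ t > 0, ∀ x ∈ frontier Ω, v t x = 0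
  contDiffOn : ∀ t > 0, ContDiffOn ℝ 2 (v t) Ω
  heat_eq : ∀ t > 0, ∀ x ∈ Ω, HasDerivAt (fun τ => v τ x) (Δ (v t) x) t
  continuousOn : ContinuousOn (fun p : ℝ × EuclideanSpace ℝ (Fin n) => v p.1 p.2)
    (Ici 0 ×ˢ closure Ω)
  bounded : ∃ M : ℝ, ∀ t ≥ 0, ∀ x ∈ closure Ω, |v t x| ≤ M

/-- `K` is the (Dirichlet) heat kernel of the open set `Ω`: it is nonnegative and continuous on
`(0, ∞) × closure Ω × Ω`, and for every `φ ∈ C_c(Ω)` the function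
`v(t, x) = ∫_Ω K(t, x, y) φ(y) dy`, `v(0) = φ`, is a bounded classical solution of the linear heat
equation on `Ω` with zero boundary values. These requirements determine `K` on
`(0, ∞) × closure Ω × Ω`, see `IsDirichletHeatKernel.unique` below. -/
structure IsDirichletHeatKernel {n : ℕ} (Ω : Set (EuclideanSpace ℝ (Fin n)))
    (K : ℝ → EuclideanSpace ℝ (Fin n) → EuclideanSpace ℝ (Fin n) → ℝ) : Prop where
  nonneg : ∀ t > 0, ∀ x ∈ closure Ω, ∀ y ∈ Ω, 0 ≤ K t x y
  continuousOn : ContinuousOn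
    (fun p : ℝ × EuclideanSpace ℝ (Fin n) × EuclideanSpace ℝ (Fin n) => K p.1 p.2.1 p.2.2)
    (Ioi 0 ×ˢ closure Ω ×ˢ Ω)
  heatSolution : ∀ φ : EuclideanSpace ℝ (Fin n) → ℝ, Continuous φ → HasCompactSupport φ →
    tsupport φ ⊆ Ω →
    IsBoundedHeatSolution Ω φ (fun t x => if t = 0 then φ x else ∫ y in Ω, K t x y * φ y)

/-- The heat semigroup with kernel `K`, acting on nonnegative functions:
`S(0) = id` and `(S(t) φ)(x) = ∫_Ω K(t, x, y) φ(y) dy` for `t > 0`. -/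
noncomputable def heatSemigroup {n : ℕ} (Ω : Set (EuclideanSpace ℝ (Fin n)))
    (K : ℝ → EuclideanSpace ℝ (Fin n) → EuclideanSpace ℝ (Fin n) → ℝ) (t : ℝ)
    (φ : EuclideanSpace ℝ (Fin n) → ℝ≥0∞) (x : EuclideanSpace ℝ (Fin n)) : ℝ≥0∞ :=
  if t = 0 then φ x else ∫⁻ y in Ω, ENNReal.ofReal (K t x y) * φ y

/-- The operator `𝓕[w](t) = S(t) φ + ∫₀ᵗ S(t - s) f(w(s)) ds`, with values in `[0, ∞]`.
(It is only applied to functions `w` that are finite almost everywhere.) -/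
noncomputable def variationOfConstants {n : ℕ} (Ω : Set (EuclideanSpace ℝ (Fin n)))
    (K : ℝ → EuclideanSpace ℝ (Fin n) → EuclideanSpace ℝ (Fin n) → ℝ) (f : ℝ≥0 → ℝ≥0)
    (φ : EuclideanSpace ℝ (Fin n) → ℝ≥0∞) (w : ℝ → EuclideanSpace ℝ (Fin n) → ℝ≥0∞)
    (t : ℝ) (x : EuclideanSpace ℝ (Fin n)) : ℝ≥0∞ :=
  heatSemigroup Ω K t φ x +
    ∫⁻ s in Ioo 0 t, heatSemigroup Ω K (t - s) (fun y => (f (w s y).toNNReal : ℝ≥0∞)) x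

/-- The space-time cylinder `Ω_T`, written as `(0, T) × Ω`; `T = ⊤` is allowed. -/
def spaceTime {n : ℕ} (Ω : Set (EuclideanSpace ℝ (Fin n))) (T : EReal) :
    Set (ℝ × EuclideanSpace ℝ (Fin n)) :=
  {p | 0 < p.1 ∧ (p.1 : EReal) < T ∧ p.2 ∈ Ω}

/-- A supersolution on `Ω_T`: a nonnegative, measurable, almost everywhere finite function `w` on
`Ω_T` with `𝓕[w] ≤ w` almost everywhere in `Ω_T`. -/
structure IsSupersolution {n : ℕ} (Ω : Set (EuclideanSpace ℝ (Fin n)))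
    (K : ℝ → EuclideanSpace ℝ (Fin n) → EuclideanSpace ℝ (Fin n) → ℝ) (f : ℝ≥0 → ℝ≥0)
    (φ : EuclideanSpace ℝ (Fin n) → ℝ≥0∞) (T : EReal)
    (w : ℝ → EuclideanSpace ℝ (Fin n) → ℝ≥0∞) : Prop where
  aemeasurable : AEMeasurable (fun p : ℝ × EuclideanSpace ℝ (Fin n) => w p.1 p.2)
    (volume.restrict (spaceTime Ω T))
  ae_finite : ∀ᵐ p ∂(volume.restrict (spaceTime Ω T)), w p.1 p.2 ≠ ∞
  le : ∀ᵐ p ∂(volume.restrict (spaceTime Ω T)),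
    variationOfConstants Ω K f φ w p.1 p.2 ≤ w p.1 p.2

section uniqueness

theorem heat_second_deriv_le {n : ℕ} {u : EuclideanSpace ℝ (Fin n) → ℝ}
    {x x₀ e : EuclideanSpace ℝ (Fin n)} {ε : ℝ} (he : ‖e‖ = 1) (hu : ContDiffAt ℝ 2 u x)
    (hmax : IsLocalMax (fun z => u z - ε * ‖z - x₀‖ ^ 2) x) :
    iteratedFDeriv ℝ 2 u x ![e, e] ≤ 2 * ε := by
  by_contra! hlt
  have hline : ∀ r : ℝ, HasDerivAt (fun r : ℝ => x + r • e) e r := fun r => by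
    simpa using ((hasDerivAt_id r).smul_const e).const_add x
  have hc : ContinuousAt (fun r : ℝ => x + r • e) 0 := (hline 0).continuousAt
  have hx0 : x + (0 : ℝ) • e = x := by simp
  have hev : ∀ᶠ r in nhds (0 : ℝ), DifferentiableAt ℝ u (x + r • e) := by
    have h1 : ∀ᶠ z in nhds x, ContDiffAt ℝ 2 u z := hu.eventually (by simp)
    rw [ContinuousAt, hx0] at hc
    filter_upwards [hc.eventually h1] with r hr using hr.differentiableAt (by simp)
  have hq : ∀ r : ℝ, ‖x + r • e - x₀‖ ^ 2 = ‖x - x₀‖ ^ 2 + 2 * r * inner ℝ (x - x₀) e + r ^ 2 := by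
    intro r
    rw [show x + r • e - x₀ = (x - x₀) + r • e by abel, norm_add_sq_real, inner_smul_right,
      norm_smul, he]
    simp; ring
  set G : ℝ → ℝ := fun r => u (x + r • e) - ε * ‖x + r • e - x₀‖ ^ 2 with hG
  have hGmax : IsLocalMax G 0 := by
    have := hmax
    rw [← hx0] at this
    exact IsLocalMax.comp_continuous (g := fun r : ℝ => x + r • e) this hc
  have hqd : ∀ r : ℝ, HasDerivAt (fun r : ℝ => ε * ‖x + r • e - x₀‖ ^ 2)
      (ε * (2 * inner ℝ (x - x₀) e + 2 * r)) r := by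
    intro r
    simp_rw [hq]
    have h1 : HasDerivAt (fun r : ℝ => ‖x - x₀‖ ^ 2 + 2 * r * inner ℝ (x - x₀) e + r ^ 2)
      (2 * inner ℝ (x - x₀) e + 2 * r) r := by
      have a : HasDerivAt (fun r : ℝ => ‖x - x₀‖ ^ 2 + 2 * r * inner ℝ (x - x₀) e)
          (2 * 1 * inner ℝ (x - x₀) e) r :=
        (((hasDerivAt_id' r).const_mul 2).mul_const (inner ℝ (x - x₀) e)).const_add _
      have b : HasDerivAt (fun r : ℝ => r ^ 2) (2 * r) r := by simpa using hasDerivAt_pow 2 r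
      rw [mul_one] at a
      exact a.add b
    exact h1.const_mul ε
  have hdG : ∀ᶠ r in nhds (0 : ℝ), HasDerivAt G
      (fderiv ℝ u (x + r • e) e - ε * (2 * inner ℝ (x - x₀) e + 2 * r)) r := by
    filter_upwards [hev] with r hr
    exact (hr.hasFDerivAt.comp_hasDerivAt r (hline r)).sub (hqd r)
  have hder : deriv G =ᶠ[nhds 0]
      fun r => fderiv ℝ u (x + r • e) e - ε * (2 * inner ℝ (x - x₀) e + 2 * r) :=
    hdG.mono fun r hr => hr.deriv
  have hfd : HasFDerivAt (fderiv ℝ u) (fderiv ℝ (fderiv ℝ u) x) (x + (0 : ℝ) • e) := by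
    rw [hx0]
    exact ((hu.fderiv_right (m := 1) (by norm_num)).differentiableAt (by simp)).hasFDerivAt
  have h2 : HasDerivAt (fun r : ℝ => fderiv ℝ u (x + r • e) e
      - ε * (2 * inner ℝ (x - x₀) e + 2 * r)) (fderiv ℝ (fderiv ℝ u) x e e - 2 * ε) 0 := by
    have a : HasDerivAt (fun r : ℝ => fderiv ℝ u (x + r • e) e)
        (fderiv ℝ (fderiv ℝ u) x e e) 0 := by
      have a1 : HasDerivAt (fun r : ℝ => fderiv ℝ u (x + r • e))
        (fderiv ℝ (fderiv ℝ u) x e) 0 := hfd.comp_hasDerivAt (0 : ℝ) (hline 0)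
      simpa using a1.clm_apply (hasDerivAt_const (0 : ℝ) e)
    have b : HasDerivAt (fun r : ℝ => ε * (2 * inner ℝ (x - x₀) e + 2 * r)) (ε * (2 * 1)) 0 :=
      (((hasDerivAt_id' (0 : ℝ)).const_mul 2).const_add (2 * inner ℝ (x - x₀) e)).const_mul ε
    have c := a.sub b
    rw [show ε * (2 * 1) = 2 * ε by ring] at c
    exact c
  have hdd : deriv (deriv G) 0 = fderiv ℝ (fderiv ℝ u) x e e - 2 * ε := by
    rw [hder.deriv_eq, h2.deriv]
  have hpos : deriv (deriv G) 0 > 0 := by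
    rw [hdd]
    rw [iteratedFDeriv_two_apply] at hlt
    simpa using hlt
  have hmin : IsLocalMin G 0 :=
    isLocalMin_of_deriv_deriv_pos hpos hGmax.deriv_eq_zero hdG.self_of_nhds.continuousAt
  have hconst : G =ᶠ[nhds 0] fun _ => G 0 := by
    filter_upwards [hGmax, hmin] with r h1 h2 using le_antisymm h1 h2
  have := hconst.deriv.deriv_eq
  simp at this
  linarith

/-- Maximum principle for bounded classical solutions of the heat equation. -/
theorem heat_max_principle {n : ℕ} {Ω : Set (EuclideanSpace ℝ (Fin n))} (hΩ : IsOpen Ω)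
    {u : ℝ → EuclideanSpace ℝ (Fin n) → ℝ} {M : ℝ}
    (h0 : ∀ x ∈ closure Ω, u 0 x ≤ 0) (hb : ∀ t > 0, ∀ x ∈ frontier Ω, u t x ≤ 0)
    (hd : ∀ t > 0, ContDiffOn ℝ 2 (u t) Ω)
    (he : ∀ t > 0, ∀ x ∈ Ω, HasDerivAt (fun τ => u τ x) (Δ (u t) x) t)
    (hc : ContinuousOn (fun p : ℝ × EuclideanSpace ℝ (Fin n) => u p.1 p.2) (Ici 0 ×ˢ closure Ω))
    (hM : ∀ t ≥ 0, ∀ x ∈ closure Ω, u t x ≤ M) :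
    ∀ t ≥ 0, ∀ x ∈ closure Ω, u t x ≤ 0 := by
  intro t₀ ht₀ x₀ hx₀
  by_contra! hpos
  set δ := u t₀ x₀ with hδ
  have hMpos : 0 < M := hpos.trans_le (hM t₀ ht₀ x₀ hx₀)
  obtain ⟨ε, hε, hεδ⟩ : ∃ ε > 0, ε * ((2 * n + 1) * t₀) < δ := by
    refine ⟨δ / (2 * ((2 * n + 1) * t₀ + 1)), by positivity, ?_⟩
    rw [div_mul_eq_mul_div, div_lt_iff₀ (by positivity)]
    nlinarith [mul_nonneg (by positivity : (0 : ℝ) ≤ 2 * n + 1) ht₀]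
  obtain ⟨R, hR, hRε⟩ : ∃ R > 0, M ≤ ε * R ^ 2 := by
    refine ⟨M / ε + 1, by positivity, ?_⟩
    have : 0 < M / ε := by positivity
    have h1 : M / ε ≤ (M / ε + 1) ^ 2 := by nlinarith
    calc M = ε * (M / ε) := by field_simp
      _ ≤ _ := by gcongr
  set z : ℝ × EuclideanSpace ℝ (Fin n) → ℝ :=
    fun p => u p.1 p.2 - ε * (‖p.2 - x₀‖ ^ 2 + (2 * n + 1) * p.1) with hz
  set C : Set (ℝ × EuclideanSpace ℝ (Fin n)) :=
    Icc 0 t₀ ×ˢ (closure Ω ∩ Metric.closedBall x₀ R) with hC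
  have hCc : IsCompact C :=
    isCompact_Icc.prod ((isCompact_closedBall x₀ R).inter_left isClosed_closure)
  have hx₀C : (t₀, x₀) ∈ C :=
    ⟨⟨ht₀, le_rfl⟩, hx₀, Metric.mem_closedBall_self hR.le⟩
  have hzc : ContinuousOn z C := by
    refine ContinuousOn.sub (hc.mono ?_) (by fun_prop)
    rintro ⟨t, x⟩ ⟨⟨h1, _⟩, h2, _⟩
    exact ⟨h1, h2⟩
  obtain ⟨⟨t₁, x₁⟩, ⟨⟨ht₁0, ht₁⟩, hx₁, hx₁R⟩, hmax⟩ := hCc.exists_isMaxOn ⟨_, hx₀C⟩ hzc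
  have hz1 : 0 < z (t₁, x₁) := by
    refine lt_of_lt_of_le ?_ (hmax hx₀C)
    simp only [hz, sub_self, norm_zero]
    simp only [ne_eq, OfNat.ofNat_ne_zero, not_false_eq_true, zero_pow, zero_add]
    linarith
  simp only [hz] at hz1
  have hnn : 0 ≤ (2 * (n : ℝ) + 1) * t₁ := mul_nonneg (by positivity) ht₁0
  have hu1 : ε * ‖x₁ - x₀‖ ^ 2 < u t₁ x₁ := by nlinarith
  have hu1' : 0 < u t₁ x₁ := lt_of_le_of_lt (by positivity) hu1
  have ht₁pos : 0 < t₁ := by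
    rcases ht₁0.lt_or_eq with h | h
    · exact h
    · simp only at h; subst h; exact absurd (h0 x₁ hx₁) (not_le.mpr hu1')
  have hx₁Ω : x₁ ∈ Ω := by
    by_contra hn
    refine absurd (hb t₁ ht₁pos x₁ ?_) (not_le.mpr hu1')
    rw [hΩ.frontier_eq]
    exact ⟨hx₁, hn⟩
  have hx₁R' : ‖x₁ - x₀‖ < R := by
    have h1 : ε * ‖x₁ - x₀‖ ^ 2 < ε * R ^ 2 := hu1.trans_le ((hM t₁ ht₁0 x₁ hx₁).trans hRε)
    exact lt_of_pow_lt_pow_left₀ 2 hR.le (lt_of_mul_lt_mul_left h1 hε.le)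
  have hloc : IsLocalMax (fun y => u t₁ y - ε * ‖y - x₀‖ ^ 2) x₁ := by
    have hball : Metric.ball x₀ R ∈ nhds x₁ :=
      Metric.isOpen_ball.mem_nhds (by simpa [dist_eq_norm] using hx₁R')
    filter_upwards [hΩ.mem_nhds hx₁Ω, hball] with y hy hyR
    have := hmax (show (t₁, y) ∈ C from
      ⟨⟨ht₁0, ht₁⟩, subset_closure hy, Metric.ball_subset_closedBall hyR⟩)
    simp only [hz, mem_ofPred_eq] at this
    linarith
  have hlap : Δ (u t₁) x₁ ≤ 2 * n * ε := by
    rw [InnerProductSpace.laplacian_eq_iteratedFDeriv_orthonormalBasis _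
      (EuclideanSpace.basisFun (Fin n) ℝ)]
    calc _ ≤ ∑ _i : Fin n, 2 * ε := Finset.sum_le_sum fun i _ =>
          heat_second_deriv_le (OrthonormalBasis.norm_eq_one _ i)
            ((hd t₁ ht₁pos).contDiffAt (hΩ.mem_nhds hx₁Ω)) hloc
      _ = 2 * n * ε := by simp; ring
  have hder : HasDerivAt (fun τ => z (τ, x₁)) (Δ (u t₁) x₁ - ε * (2 * n + 1)) t₁ := by
    refine (he t₁ ht₁pos x₁ hx₁Ω).sub (HasDerivAt.const_mul ε ?_)
    simpa using ((hasDerivAt_id t₁).const_mul (2 * (n : ℝ) + 1)).const_add (‖x₁ - x₀‖ ^ 2)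
  have hneg : Δ (u t₁) x₁ - ε * (2 * n + 1) < 0 := by nlinarith
  have hslope := hder.tendsto_slope.eventually (gt_mem_nhds hneg)
  have hleft : ∀ᶠ τ in nhdsWithin t₁ (Iio t₁), slope (fun τ => z (τ, x₁)) t₁ τ < 0 :=
    hslope.filter_mono (nhdsWithin_mono _ fun τ (hτ : τ < t₁) => ne_of_lt hτ)
  have hIoo : ∀ᶠ τ in nhdsWithin t₁ (Iio t₁), τ ∈ Ioo 0 t₁ := Ioo_mem_nhdsLT ht₁pos
  obtain ⟨τ, hτs, hτ0, hτ1⟩ := (hleft.and hIoo).exists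
  have hmτ := hmax (show (τ, x₁) ∈ C from ⟨⟨hτ0.le, hτ1.le.trans ht₁⟩, hx₁, hx₁R⟩)
  simp only [mem_ofPred_eq] at hmτ
  rw [slope_def_field, div_neg_iff] at hτs
  rcases hτs with h | h <;> linarith [h.1, h.2]

/-- Bounded classical solutions are unique. -/
theorem IsBoundedHeatSolution.unique {n : ℕ} {Ω : Set (EuclideanSpace ℝ (Fin n))} (hΩ : IsOpen Ω)
    {φ : EuclideanSpace ℝ (Fin n) → ℝ} {v₁ v₂ : ℝ → EuclideanSpace ℝ (Fin n) → ℝ}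
    (h₁ : IsBoundedHeatSolution Ω φ v₁) (h₂ : IsBoundedHeatSolution Ω φ v₂) :
    ∀ t ≥ 0, ∀ x ∈ closure Ω, v₁ t x = v₂ t x := by
  have key : ∀ {v₁ v₂ : ℝ → EuclideanSpace ℝ (Fin n) → ℝ}, IsBoundedHeatSolution Ω φ v₁ →
      IsBoundedHeatSolution Ω φ v₂ → ∀ t ≥ 0, ∀ x ∈ closure Ω, v₁ t x - v₂ t x ≤ 0 := by
    intro v₁ v₂ h₁ h₂
    obtain ⟨M₁, hM₁⟩ := h₁.bounded
    obtain ⟨M₂, hM₂⟩ := h₂.bounded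
    refine heat_max_principle (u := fun t => v₁ t - v₂ t) (M := M₁ + M₂) hΩ ?_ ?_ ?_ ?_ ?_ ?_
    · intro x hx
      simp [h₁.initial x hx, h₂.initial x hx]
    · intro t ht x hx
      simp [h₁.boundary t ht x hx, h₂.boundary t ht x hx]
    · exact fun t ht => (h₁.contDiffOn t ht).sub (h₂.contDiffOn t ht)
    · intro t ht x hx
      have hn := hΩ.mem_nhds hx
      rw [((h₁.contDiffOn t ht).contDiffAt hn).laplacian_sub ((h₂.contDiffOn t ht).contDiffAt hn)]
      exact (h₁.heat_eq t ht x hx).sub (h₂.heat_eq t ht x hx)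
    · exact h₁.continuousOn.sub h₂.continuousOn
    · intro t ht x hx
      have a := abs_le.mp (hM₁ t ht x hx)
      have b := abs_le.mp (hM₂ t ht x hx)
      simp only [Pi.sub_apply]
      linarith [a.2, b.1]
  intro t ht x hx
  linarith [key h₁ h₂ t ht x hx, key h₂ h₁ t ht x hx]

/-- An open set has at most one heat kernel. -/
theorem IsDirichletHeatKernel.unique {n : ℕ} {Ω : Set (EuclideanSpace ℝ (Fin n))} (hΩ : IsOpen Ω)
    {K₁ K₂ : ℝ → EuclideanSpace ℝ (Fin n) → EuclideanSpace ℝ (Fin n) → ℝ}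
    (h₁ : IsDirichletHeatKernel Ω K₁) (h₂ : IsDirichletHeatKernel Ω K₂) :
    ∀ t > 0, ∀ x ∈ closure Ω, ∀ y ∈ Ω, K₁ t x y = K₂ t x y := by
  intro t ht x hx
  have hcont : ∀ {K : ℝ → EuclideanSpace ℝ (Fin n) → EuclideanSpace ℝ (Fin n) → ℝ},
      IsDirichletHeatKernel Ω K → ContinuousOn (K t x) Ω := by
    intro K h
    exact h.continuousOn.comp (f := fun y => (t, x, y)) (by fun_prop) fun y hy => ⟨ht, hx, hy⟩
  have hae : ∀ᵐ y ∂(volume : Measure (EuclideanSpace ℝ (Fin n))), y ∈ Ω →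
      K₁ t x y - K₂ t x y = 0 := by
    refine hΩ.ae_eq_zero_of_integral_contDiff_smul_eq_zero
      (((hcont h₁).sub (hcont h₂)).locallyIntegrableOn hΩ.measurableSet) ?_
    intro φ hφ hφc hφs
    have hint : ∀ {K : ℝ → EuclideanSpace ℝ (Fin n) → EuclideanSpace ℝ (Fin n) → ℝ},
        IsDirichletHeatKernel Ω K → IntegrableOn (fun y => K t x y * φ y) Ω := by
      intro K h
      have h1 : IntegrableOn (fun y => K t x y * φ y) (tsupport φ) :=
        (((hcont h).mono hφs).mul hφ.continuous.continuousOn).integrableOn_compact hφc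
      refine h1.of_forall_sdiff_eq_zero hΩ.measurableSet fun y hy => ?_
      rw [image_eq_zero_of_notMem_tsupport hy.2, mul_zero]
    have e := IsBoundedHeatSolution.unique hΩ (h₁.heatSolution φ hφ.continuous hφc hφs)
      (h₂.heatSolution φ hφ.continuous hφc hφs) t ht.le x hx
    simp only [ht.ne', if_false] at e
    have hs : ∫ y, φ y • (K₁ t x y - K₂ t x y) = ∫ y in Ω, φ y • (K₁ t x y - K₂ t x y) := by
      refine (setIntegral_eq_integral_of_forall_compl_eq_zero fun y hy => ?_).symm
      rw [image_eq_zero_of_notMem_tsupport fun h => hy (hφs h), zero_smul]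
    rw [hs]
    calc ∫ y in Ω, φ y • (K₁ t x y - K₂ t x y)
        = ∫ y in Ω, (K₁ t x y * φ y - K₂ t x y * φ y) := by
          congr 1; ext y; simp; ring
      _ = 0 := by rw [integral_sub (hint h₁) (hint h₂), e, sub_self]
  have heq : K₁ t x =ᵐ[volume.restrict Ω] K₂ t x := by
    rw [Filter.EventuallyEq, ae_restrict_iff' hΩ.measurableSet]
    filter_upwards [hae] with y hy hyΩ using sub_eq_zero.mp (hy hyΩ)
  exact Measure.eqOn_open_of_ae_eq heq hΩ (hcont h₁) (hcont h₂)

end uniqueness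

/-! The heart is a short comparison. Write `H t` for the integral of `h` over `(0, t)`. The
condition on `A` turns `S(t)φ ≤ g(S(t)ψ)` into `w(t) ≤ A g(S(t)ψ)`, so monotonicity of `f` and the
definition of `h` give `f(w(s)) ≤ f(A g(S(s)ψ)) ≤ h(s) S(s)ψ` a.e. Applying `S(t - s)` gives `S(t -
s) f(w(s)) ≤ h(s) S(t)ψ`, and integration in `s` gives `𝓕[w](t) ≤ S(t)φ + S(t)ψ H t = w(t)`.

Two facts about the kernel are needed, and both must come from its action on `C_c(Ω)`, where
`heat_max_principle` is available.

The first is `S(τ)S(s) ≤ S(τ + s)`; the reverse inequality plays no role. For a test function, the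
flow at time `s` is truncated by a cutoff to a new test function, whose own flow stays below the
original flow by the maximum principle. Monotone convergence removes the cutoff, bumps concentrating
at `y` together with Fatou's lemma give the kernel inequality `lintegral_kernel_mul_kernel_le`, and
Tonelli extends it to all nonnegative measurable data.

The second is finiteness of `S(t)ψ` on `Ω` for integrable `ψ`, which follows from a bound on `K t`
(`exists_bound`). A normalized bump at `y` lies below a multiple, independent of its radius, of a
Gaussian solution of the heat equation; so does its flow, and the bound passes to the limit. -/

open Filter Topology

/-! ### Gaussian solutions of the heat equation -/

/-- The Laplacian of an isotropic Gaussian. -/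
theorem laplacian_exp_neg_mul_norm_sub_sq {n : ℕ} (a : ℝ) (y x : EuclideanSpace ℝ (Fin n)) :
    Δ (fun z => Real.exp (-(a * ‖z - y‖ ^ 2))) x =
      Real.exp (-(a * ‖x - y‖ ^ 2)) * (4 * a ^ 2 * ‖x - y‖ ^ 2 - 2 * a * n) := by
  have hexp : ∀ z : EuclideanSpace ℝ (Fin n),
      HasFDerivAt (fun z => Real.exp (-(a * ‖z - y‖ ^ 2)))
        ((Real.exp (-(a * ‖z - y‖ ^ 2)) * (-(2 * a))) • innerSL ℝ (z - y)) z := by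
    intro z
    have h1 : HasFDerivAt (fun z => ‖z - y‖ ^ 2) (2 • innerSL ℝ (z - y)) z := by
      simpa using ((hasFDerivAt_id z).sub_const y).norm_sq
    have h2 : HasFDerivAt (fun z => -(a * ‖z - y‖ ^ 2)) (-(a • 2 • innerSL ℝ (z - y))) z :=
      (h1.const_mul a).neg
    refine h2.exp.congr_fderiv ?_
    ext v
    simp
    ring
  have hfd : fderiv ℝ (fun z => Real.exp (-(a * ‖z - y‖ ^ 2))) =
      fun z => (Real.exp (-(a * ‖z - y‖ ^ 2)) * (-(2 * a))) • innerSL ℝ (z - y) :=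
    funext fun z => (hexp z).fderiv
  have hinner : HasFDerivAt (fun z => innerSL ℝ (z - y)) (innerSL ℝ) x := by
    have h1 : HasFDerivAt (fun z => z - y) (ContinuousLinearMap.id ℝ _) x :=
      (hasFDerivAt_id x).sub_const y
    exact (innerSL ℝ (E := EuclideanSpace ℝ (Fin n))).hasFDerivAt.comp x h1
  rw [InnerProductSpace.laplacian_eq_iteratedFDeriv_orthonormalBasis _
    (EuclideanSpace.basisFun (Fin n) ℝ)]
  have hterm : ∀ i : Fin n, iteratedFDeriv ℝ 2 (fun z => Real.exp (-(a * ‖z - y‖ ^ 2))) x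
      ![EuclideanSpace.basisFun (Fin n) ℝ i, EuclideanSpace.basisFun (Fin n) ℝ i] =
      Real.exp (-(a * ‖x - y‖ ^ 2)) * (4 * a ^ 2 * (x - y) i ^ 2 - 2 * a) := by
    intro i
    have h2 : HasFDerivAt
        (fun z => (Real.exp (-(a * ‖z - y‖ ^ 2)) * (-(2 * a))) • innerSL ℝ (z - y)) _ x :=
      ((hexp x).mul_const (-(2 * a))).smul hinner
    rw [iteratedFDeriv_two_apply, hfd, h2.fderiv]
    have h3 : innerSL ℝ (EuclideanSpace.single i (1 : ℝ)) (EuclideanSpace.single i (1 : ℝ)) =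
        (1 : ℝ) := by
      rw [innerSL_apply_apply]
      simp
    simp [EuclideanSpace.inner_single_right, h3]
    ring
  simp only [hterm]
  rw [← Finset.mul_sum, Finset.sum_sub_distrib, ← Finset.mul_sum, EuclideanSpace.real_norm_sq_eq]
  simp
  ring

theorem laplacian_const_mul {n : ℕ} (c : ℝ) {u : EuclideanSpace ℝ (Fin n) → ℝ}
    {x : EuclideanSpace ℝ (Fin n)} (hu : ContDiffAt ℝ 2 u x) :
    Δ (fun z => c * u z) x = c * Δ u x :=
  InnerProductSpace.laplacian_smul c hu

theorem contDiff_exp_neg_mul_norm_sub_sq {n : ℕ} (a : ℝ) (y : EuclideanSpace ℝ (Fin n)) :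
    ContDiff ℝ 2 fun z => Real.exp (-(a * ‖z - y‖ ^ 2)) := by
  have h1 : ContDiff ℝ 2 fun z : EuclideanSpace ℝ (Fin n) => ‖z - y‖ ^ 2 :=
    (contDiff_id.sub contDiff_const).norm_sq ℝ
  exact (contDiff_const.mul h1).neg.exp

/-- The Gaussian `t ^ (-n / 2) * exp (-‖x - y‖² / (4 t))` solves the heat equation. -/
theorem hasDerivAt_gaussian_heat {n : ℕ} (y x : EuclideanSpace ℝ (Fin n)) {t : ℝ} (ht : 0 < t) :
    HasDerivAt (fun τ : ℝ => τ ^ (-(n : ℝ) / 2) * Real.exp (-((4 * τ)⁻¹ * ‖x - y‖ ^ 2)))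
      (Δ (fun z => t ^ (-(n : ℝ) / 2) * Real.exp (-((4 * t)⁻¹ * ‖z - y‖ ^ 2))) x) t := by
  have hL : Δ (fun z => t ^ (-(n : ℝ) / 2) * Real.exp (-((4 * t)⁻¹ * ‖z - y‖ ^ 2))) x =
      t ^ (-(n : ℝ) / 2) * (Real.exp (-((4 * t)⁻¹ * ‖x - y‖ ^ 2)) *
        (4 * ((4 * t)⁻¹) ^ 2 * ‖x - y‖ ^ 2 - 2 * (4 * t)⁻¹ * n)) := by
    rw [← laplacian_exp_neg_mul_norm_sub_sq]
    exact laplacian_const_mul _ (contDiff_exp_neg_mul_norm_sub_sq _ _).contDiffAt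
  rw [hL]
  have h1 : HasDerivAt (fun τ : ℝ => τ ^ (-(n : ℝ) / 2))
      (-(n : ℝ) / 2 * t ^ (-(n : ℝ) / 2 - 1)) t :=
    Real.hasDerivAt_rpow_const (Or.inl ht.ne')
  have h2 : HasDerivAt (fun τ : ℝ => (4 * τ)⁻¹) (-(4 * 1) / (4 * t) ^ 2) t :=
    ((hasDerivAt_id t).const_mul 4).inv (by positivity)
  have h3 : HasDerivAt (fun τ : ℝ => -((4 * τ)⁻¹ * ‖x - y‖ ^ 2))
      (-(-(4 * 1) / (4 * t) ^ 2 * ‖x - y‖ ^ 2)) t := (h2.mul_const _).neg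
  refine (h1.mul h3.exp).congr_deriv ?_
  rw [Real.rpow_sub_one ht.ne']
  field_simp
  ring

/-! ### Gaussian comparison and boundedness of the kernel -/

section kernel

variable {n : ℕ} {Ω : Set (EuclideanSpace ℝ (Fin n))}
  {K : ℝ → EuclideanSpace ℝ (Fin n) → EuclideanSpace ℝ (Fin n) → ℝ}

theorem IsDirichletHeatKernel.continuousOn_right (hK : IsDirichletHeatKernel Ω K) {t : ℝ}
    (ht : 0 < t) {x : EuclideanSpace ℝ (Fin n)} (hx : x ∈ closure Ω) :
    ContinuousOn (K t x) Ω :=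
  hK.continuousOn.comp (f := fun y => (t, x, y)) (by fun_prop) fun _ hy => ⟨ht, hx, hy⟩

theorem IsDirichletHeatKernel.continuousOn_spatial (hK : IsDirichletHeatKernel Ω K) {t : ℝ}
    (ht : 0 < t) :
    ContinuousOn (fun p : EuclideanSpace ℝ (Fin n) × EuclideanSpace ℝ (Fin n) => K t p.1 p.2)
      (closure Ω ×ˢ Ω) :=
  hK.continuousOn.comp
    (f := fun p : EuclideanSpace ℝ (Fin n) × EuclideanSpace ℝ (Fin n) => (t, p.1, p.2))
    (by fun_prop) fun _ hp => ⟨ht, hp.1, hp.2⟩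

theorem IsDirichletHeatKernel.integrableOn_mul (hK : IsDirichletHeatKernel Ω K) (hΩ : IsOpen Ω)
    {t : ℝ} (ht : 0 < t) {x : EuclideanSpace ℝ (Fin n)} (hx : x ∈ closure Ω)
    {φ : EuclideanSpace ℝ (Fin n) → ℝ} (hφ : Continuous φ) (hφc : HasCompactSupport φ)
    (hφs : tsupport φ ⊆ Ω) : IntegrableOn (fun y => K t x y * φ y) Ω := by
  have h1 : IntegrableOn (fun y => K t x y * φ y) (tsupport φ) :=
    (((hK.continuousOn_right ht hx).mono hφs).mul hφ.continuousOn).integrableOn_compact hφc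
  refine h1.of_forall_sdiff_eq_zero hΩ.measurableSet fun y hy => ?_
  rw [image_eq_zero_of_notMem_tsupport hy.2, mul_zero]

theorem IsDirichletHeatKernel.integral_mul_nonneg (hK : IsDirichletHeatKernel Ω K)
    (hΩ : IsOpen Ω) {t : ℝ} (ht : 0 < t) {x : EuclideanSpace ℝ (Fin n)} (hx : x ∈ closure Ω)
    {φ : EuclideanSpace ℝ (Fin n) → ℝ} (hφ0 : ∀ y, 0 ≤ φ y) : 0 ≤ ∫ y in Ω, K t x y * φ y :=
  setIntegral_nonneg hΩ.measurableSet fun y hy => mul_nonneg (hK.nonneg t ht x hx y hy) (hφ0 y)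

/-- Comparison of the heat flow of a test function with a Gaussian concentrated near `y`. -/
theorem IsDirichletHeatKernel.integral_mul_le_gaussian (hK : IsDirichletHeatKernel Ω K)
    (hΩ : IsOpen Ω) {φ : EuclideanSpace ℝ (Fin n) → ℝ} (hφ : Continuous φ)
    (hφc : HasCompactSupport φ) (hφs : tsupport φ ⊆ Ω) {y : EuclideanSpace ℝ (Fin n)}
    {C δ : ℝ} (hC : 0 ≤ C) (hδ : 0 < δ)
    (hle : ∀ z, φ z ≤ C * (δ ^ (-(n : ℝ) / 2) * Real.exp (-((4 * δ)⁻¹ * ‖z - y‖ ^ 2))))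
    {t : ℝ} (ht : 0 < t) {x : EuclideanSpace ℝ (Fin n)} (hx : x ∈ closure Ω) :
    ∫ z in Ω, K t x z * φ z ≤
      C * ((t + δ) ^ (-(n : ℝ) / 2) * Real.exp (-((4 * (t + δ))⁻¹ * ‖x - y‖ ^ 2))) := by
  have hv := hK.heatSolution φ hφ hφc hφs
  set v : ℝ → EuclideanSpace ℝ (Fin n) → ℝ :=
    fun t x => if t = 0 then φ x else ∫ y in Ω, K t x y * φ y with hvdef
  obtain ⟨M, hM⟩ := hv.bounded
  set G : ℝ → EuclideanSpace ℝ (Fin n) → ℝ := fun t x =>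
    C * ((t + δ) ^ (-(n : ℝ) / 2) * Real.exp (-((4 * (t + δ))⁻¹ * ‖x - y‖ ^ 2))) with hG
  have hG0 : ∀ t ≥ 0, ∀ x, 0 ≤ G t x := fun t ht x => by
    have : 0 ≤ (t + δ) ^ (-(n : ℝ) / 2) := Real.rpow_nonneg (by linarith) _
    positivity
  have hgc : ∀ t : ℝ, ContDiff ℝ 2 fun x : EuclideanSpace ℝ (Fin n) =>
      (t + δ) ^ (-(n : ℝ) / 2) * Real.exp (-((4 * (t + δ))⁻¹ * ‖x - y‖ ^ 2)) := fun t =>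
    contDiff_const.mul (contDiff_exp_neg_mul_norm_sub_sq _ _)
  have hGc : ∀ t, ContDiff ℝ 2 (G t) := fun t => contDiff_const.mul (hgc t)
  -- Only an upper bound is required, so the bound `M` for `v` serves for `v - G` because `G ≥ 0`.
  -- The same sign settles the lateral boundary, where `v = 0`.
  have key := heat_max_principle (u := fun t => v t - G t) (M := M) hΩ ?_ ?_ ?_ ?_ ?_ ?_
    t ht.le x hx
  · simp only [Pi.sub_apply, hvdef, ht.ne', if_false, hG] at key
    linarith
  · intro z hz
    simpa [hv.initial z hz, hG] using hle z
  · intro t ht z hz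
    simpa [hv.boundary t ht z hz] using hG0 t ht.le z
  · exact fun t ht => (hv.contDiffOn t ht).sub (hGc t).contDiffOn
  · intro t ht z hz
    rw [((hv.contDiffOn t ht).contDiffAt (hΩ.mem_nhds hz)).laplacian_sub (hGc t).contDiffAt]
    refine (hv.heat_eq t ht z hz).sub ?_
    have h1 := (hasDerivAt_gaussian_heat y z (by linarith : 0 < t + δ)).comp_add_const t δ
    have h2 : Δ (G t) z = C * Δ (fun x : EuclideanSpace ℝ (Fin n) =>
        (t + δ) ^ (-(n : ℝ) / 2) * Real.exp (-((4 * (t + δ))⁻¹ * ‖x - y‖ ^ 2))) z :=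
      laplacian_const_mul C (hgc t).contDiffAt
    rw [h2]
    exact h1.const_mul C
  · refine hv.continuousOn.sub ?_
    have hpos : ∀ p ∈ (Ici 0 ×ˢ closure Ω : Set (ℝ × EuclideanSpace ℝ (Fin n))),
        p.1 + δ ≠ 0 := fun p hp => by
      have : 0 ≤ p.1 := hp.1
      positivity
    refine continuousOn_const.mul (ContinuousOn.mul ?_ ?_)
    · exact ContinuousOn.rpow_const (by fun_prop) fun p hp => Or.inl (hpos p hp)
    · refine ContinuousOn.rexp (ContinuousOn.neg (ContinuousOn.mul ?_ (by fun_prop)))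
      exact ContinuousOn.inv₀ (by fun_prop) fun p hp => mul_ne_zero four_ne_zero (hpos p hp)
  · intro t ht z hz
    have := (abs_le.mp (hM t ht z hz)).2
    have := hG0 t ht z
    simp only [Pi.sub_apply]
    linarith

/-- Averages of a continuous function against shrinking normalized bumps converge. -/
theorem exists_bump_tendsto (hΩ : IsOpen Ω) {y : EuclideanSpace ℝ (Fin n)} (hy : y ∈ Ω) :
    ∃ b : ℕ → ContDiffBump y, (∀ k, (b k).rOut = 2 * (b k).rIn) ∧
      (∀ k, Metric.closedBall y (b k).rOut ⊆ Ω) ∧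
      ∀ a : EuclideanSpace ℝ (Fin n) → ℝ, ContinuousOn a Ω →
        Tendsto (fun k => ∫ z in Ω, a z * (b k).normed volume z) atTop (𝓝 (a y)) := by
  obtain ⟨r, hr, hrΩ⟩ := Metric.nhds_basis_closedBall.mem_iff.mp (hΩ.mem_nhds hy)
  -- The fixed ratio of the radii keeps the height of the normalized bump at most a constant times
  -- `rOut ^ (-n)`, the height of a Gaussian at time `rOut ^ 2`.
  let b : ℕ → ContDiffBump y := fun k =>
    ⟨r / (k + 2), 2 * (r / (k + 2)), by positivity, by
      have : 0 < r / (k + 2) := by positivity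
      linarith⟩
  have hbr : ∀ k, (b k).rOut ≤ r := fun k => by
    change 2 * (r / (k + 2)) ≤ r
    rw [← mul_div_assoc, div_le_iff₀ (by positivity)]
    nlinarith [mul_nonneg hr.le (Nat.cast_nonneg k (α := ℝ))]
  have hbΩ : ∀ k, Metric.closedBall y (b k).rOut ⊆ Ω := fun k =>
    (Metric.closedBall_subset_closedBall (hbr k)).trans hrΩ
  have hb0 : Tendsto (fun k => (b k).rOut) atTop (𝓝 0) := by
    have h1 : Tendsto (fun k : ℕ => (k : ℝ) + 2) atTop atTop :=
      tendsto_atTop_add_const_right _ _ tendsto_natCast_atTop_atTop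
    simpa using (tendsto_const_nhds (x := r)).div_atTop h1 |>.const_mul 2
  refine ⟨b, fun k => rfl, hbΩ, fun a ha => ?_⟩
  rw [Metric.tendsto_atTop]
  intro ε hε
  obtain ⟨ρ, hρ, hρa⟩ := Metric.continuousAt_iff.mp (ha.continuousAt (hΩ.mem_nhds hy)) (ε / 2)
    (by positivity)
  obtain ⟨N, hN⟩ := (hb0.eventually (gt_mem_nhds hρ)).exists_forall_of_atTop
  refine ⟨N, fun k hk => ?_⟩
  set φ := (b k).normed volume with hφ
  have hφ0 : ∀ z, z ∉ Metric.closedBall y (b k).rOut → φ z = 0 := fun z hz => by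
    rw [← (b k).tsupport_normed_eq (μ := volume)] at hz
    exact image_eq_zero_of_notMem_tsupport hz
  have hset : ∀ c : EuclideanSpace ℝ (Fin n) → ℝ,
      ∫ z in Ω, c z * φ z = ∫ z in Metric.closedBall y (b k).rOut, c z * φ z := fun c =>
    setIntegral_eq_of_subset_of_forall_sdiff_eq_zero hΩ.measurableSet (hbΩ k)
      fun z hz => by rw [hφ0 z hz.2, mul_zero]
  have hcomp : IsCompact (Metric.closedBall y (b k).rOut) := isCompact_closedBall _ _
  have hφc : Continuous φ := (b k).continuous_normed
  have hint1 : IntegrableOn (fun z => a z * φ z) (Metric.closedBall y (b k).rOut) :=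
    ((ha.mono (hbΩ k)).mul hφc.continuousOn).integrableOn_compact hcomp
  have hint2 : IntegrableOn φ (Metric.closedBall y (b k).rOut) :=
    hφc.continuousOn.integrableOn_compact hcomp
  have hone : ∫ z in Metric.closedBall y (b k).rOut, φ z = 1 := by
    rw [setIntegral_eq_integral_of_forall_compl_eq_zero hφ0]
    exact (b k).integral_normed
  have hdiff : (∫ z in Ω, a z * φ z) - a y =
      ∫ z in Metric.closedBall y (b k).rOut, (a z - a y) * φ z := by
    simp only [sub_mul]
    rw [integral_sub hint1 (hint2.const_mul _), integral_const_mul, hone, hset, mul_one]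
  rw [Real.dist_eq, hdiff]
  calc |∫ z in Metric.closedBall y (b k).rOut, (a z - a y) * φ z|
      ≤ ∫ z in Metric.closedBall y (b k).rOut, ε / 2 * φ z := by
        rw [← Real.norm_eq_abs]
        refine norm_integral_le_of_norm_le (hint2.const_mul _) ?_
        refine ae_restrict_of_forall_mem measurableSet_closedBall fun z hz => ?_
        rw [norm_mul, Real.norm_of_nonneg ((b k).nonneg_normed z)]
        refine mul_le_mul_of_nonneg_right ?_ ((b k).nonneg_normed z)
        rw [← dist_eq_norm]
        exact (hρa ((Metric.mem_closedBall.mp hz).trans_lt (hN k hk))).le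
    _ = ε / 2 := by rw [integral_const_mul, hone, mul_one]
    _ < ε := by linarith

/-- The heat kernel is bounded in its second spatial variable. -/
theorem IsDirichletHeatKernel.exists_bound (hK : IsDirichletHeatKernel Ω K) (hΩ : IsOpen Ω)
    {t : ℝ} (ht : 0 < t) : ∃ B : ℝ, ∀ x ∈ closure Ω, ∀ y ∈ Ω, K t x y ≤ B := by
  set c := volume.real (Metric.ball (0 : EuclideanSpace ℝ (Fin n)) 1) with hc
  have hc0 : 0 < c := ENNReal.toReal_pos (Metric.isOpen_ball.measure_pos _ ⟨0, by simp⟩).ne'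
    measure_ball_lt_top.ne
  -- A bump of outer radius `r` has height at most `1 / (c (r / 2) ^ n)`, hence the factor `2 ^ n /
  -- c`. On its support the Gaussian at time `δ = r ^ 2` has exponential factor at least `exp
  -- (-1/4)`, which `exp (1/4)` compensates. At time `t + r ^ 2` the Gaussian is at most `t ^ (-n /
  -- 2)`, so `r` drops out.
  refine ⟨2 ^ n / c * Real.exp 4⁻¹ * t ^ (-(n : ℝ) / 2), fun x hx y hy => ?_⟩
  obtain ⟨b, hb2, hbΩ, hb⟩ := exists_bump_tendsto hΩ hy
  refine le_of_tendsto' (hb _ (hK.continuousOn_right ht hx)) fun k => ?_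
  set r := (b k).rOut with hr
  have hr0 : 0 < r := (b k).rOut_pos
  have hrn : (r ^ 2) ^ (-(n : ℝ) / 2) = (r ^ n)⁻¹ := by
    rw [← Real.rpow_natCast r 2, ← Real.rpow_mul hr0.le, ← Real.rpow_natCast r n,
      ← Real.rpow_neg hr0.le]
    congr 1
    push_cast
    ring
  have hmain := hK.integral_mul_le_gaussian hΩ (φ := (b k).normed volume) (y := y)
    (C := 2 ^ n / c * Real.exp 4⁻¹) (δ := r ^ 2) (b k).continuous_normed
    (b k).hasCompactSupport_normed (by rw [(b k).tsupport_normed_eq]; exact hbΩ k)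
    (by positivity) (by positivity) ?_ ht hx
  · refine hmain.trans (mul_le_mul_of_nonneg_left ?_ (by positivity))
    calc (t + r ^ 2) ^ (-(n : ℝ) / 2) * Real.exp (-((4 * (t + r ^ 2))⁻¹ * ‖x - y‖ ^ 2))
        ≤ t ^ (-(n : ℝ) / 2) * 1 := by
          refine mul_le_mul ?_ ?_ (Real.exp_nonneg _) (Real.rpow_nonneg ht.le _)
          · refine Real.rpow_le_rpow_of_nonpos ht (by nlinarith) ?_
            have : (0 : ℝ) ≤ n := n.cast_nonneg
            linarith
          · rw [Real.exp_le_one_iff, neg_nonpos]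
            positivity
      _ = _ := mul_one _
  · intro z
    by_cases hz : z ∈ Metric.closedBall y r
    · have h1 := (b k).normed_le_div_measure_closedBall_rIn volume z
      rw [Measure.addHaar_real_closedBall _ _ (b k).rIn_pos.le, finrank_euclideanSpace_fin,
        show (b k).rIn = r / 2 by rw [hr, hb2]; ring] at h1
      refine h1.trans ?_
      have h2 : 1 ≤ Real.exp 4⁻¹ * Real.exp (-((4 * r ^ 2)⁻¹ * ‖z - y‖ ^ 2)) := by
        rw [← Real.exp_add, Real.one_le_exp_iff]
        have h3 : ‖z - y‖ ^ 2 ≤ r ^ 2 := by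
          rw [← dist_eq_norm]
          exact pow_le_pow_left₀ dist_nonneg hz 2
        have h4 : (4 * r ^ 2)⁻¹ * ‖z - y‖ ^ 2 ≤ (4 * r ^ 2)⁻¹ * r ^ 2 := by gcongr
        have h5 : (4 * r ^ 2)⁻¹ * r ^ 2 = 4⁻¹ := by field_simp
        linarith
      rw [hrn]
      calc 1 / ((r / 2) ^ n * c) = 2 ^ n / c * (r ^ n)⁻¹ * 1 := by
            rw [div_pow]
            field_simp
        _ ≤ 2 ^ n / c * (r ^ n)⁻¹ *
            (Real.exp 4⁻¹ * Real.exp (-((4 * r ^ 2)⁻¹ * ‖z - y‖ ^ 2))) := by gcongr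
        _ = _ := by ring
    · rw [← (b k).tsupport_normed_eq (μ := volume)] at hz
      rw [image_eq_zero_of_notMem_tsupport hz]
      have : 0 ≤ (r ^ 2) ^ (-(n : ℝ) / 2) := Real.rpow_nonneg (by positivity) _
      positivity

end kernel

/-! ### Sub-semigroup property, finiteness and measurability of the heat flow -/

section semigroup

variable {n : ℕ} {Ω : Set (EuclideanSpace ℝ (Fin n))}
  {K : ℝ → EuclideanSpace ℝ (Fin n) → EuclideanSpace ℝ (Fin n) → ℝ}

theorem exists_cutoff (hΩ : IsOpen Ω) {C : Set (EuclideanSpace ℝ (Fin n))} (hC : IsCompact C)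
    (hCΩ : C ⊆ Ω) : ∃ χ : EuclideanSpace ℝ (Fin n) → ℝ, Continuous χ ∧ HasCompactSupport χ ∧
      tsupport χ ⊆ Ω ∧ (∀ z, χ z ∈ Icc 0 1) ∧ ∀ z ∈ C, χ z = 1 := by
  obtain ⟨D, hD, hCD, hDΩ⟩ := exists_compact_between hC hΩ hCΩ
  obtain ⟨χ, h1, h0, hc, hI⟩ := exists_continuous_one_zero_of_isCompact hC
    isOpen_interior.isClosed_compl (disjoint_compl_right_iff_subset.mpr hCD)
  refine ⟨χ, χ.continuous, hc, ?_, hI, fun z hz => h1 hz⟩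
  refine (closure_minimal (fun z hz => ?_) hD.isClosed).trans hDΩ
  by_contra hn
  exact hz (h0 fun h => hn (interior_subset h))

/-- The heat flow started from a truncation of the heat flow of `φ` at time `s` stays below the
heat flow of `φ`. -/
theorem IsDirichletHeatKernel.integral_cutoff_le (hK : IsDirichletHeatKernel Ω K)
    (hΩ : IsOpen Ω) {φ χ : EuclideanSpace ℝ (Fin n) → ℝ} (hφ : Continuous φ)
    (hφc : HasCompactSupport φ) (hφs : tsupport φ ⊆ Ω) (hφ0 : ∀ z, 0 ≤ φ z)
    (hχ : Continuous χ) (hχc : HasCompactSupport χ) (hχs : tsupport χ ⊆ Ω)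
    (hχ1 : ∀ z, χ z ∈ Icc 0 1) {s τ : ℝ} (hs : 0 < s) (hτ : 0 < τ)
    {x : EuclideanSpace ℝ (Fin n)} (hx : x ∈ closure Ω) :
    IntegrableOn (fun z => K τ x z * (χ z * ∫ y in Ω, K s z y * φ y)) Ω ∧
    ∫ z in Ω, K τ x z * (χ z * ∫ y in Ω, K s z y * φ y) ≤ ∫ y in Ω, K (τ + s) x y * φ y := by
  have hv := hK.heatSolution φ hφ hφc hφs
  set v : ℝ → EuclideanSpace ℝ (Fin n) → ℝ :=
    fun t x => if t = 0 then φ x else ∫ y in Ω, K t x y * φ y with hvdef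
  have hvs : ∀ t > 0, v t = fun x => ∫ y in Ω, K t x y * φ y := fun t ht => by
    simp [hvdef, ht.ne']
  have hv0 : ∀ t > 0, ∀ z ∈ closure Ω, 0 ≤ v t z := fun t ht z hz => by
    rw [hvs t ht]
    exact hK.integral_mul_nonneg hΩ ht hz hφ0
  -- `v s` need not have compact support in `Ω`, so it is not an admissible initial value; `χ * v s`
  -- is, and it lies below `v s` since `0 ≤ χ ≤ 1` and `v s ≥ 0`.
  set ρ : EuclideanSpace ℝ (Fin n) → ℝ := fun z => χ z * ∫ y in Ω, K s z y * φ y with hρ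
  have hρv : ∀ z, ρ z = χ z * v s z := fun z => by rw [hvs s hs]
  have hρs : tsupport ρ ⊆ Ω := (closure_mono (Function.support_mul_subset_left _ _)).trans hχs
  have hρcont : Continuous ρ := by
    refine ContinuousOn.continuous_of_tsupport_subset ?_ hΩ hρs
    have := (hv.contDiffOn s hs).continuousOn
    rw [hvs s hs] at this
    exact hχ.continuousOn.mul this
  have hρc : HasCompactSupport ρ := hχc.mul_right
  refine ⟨hK.integrableOn_mul hΩ hτ hx hρcont hρc hρs, ?_⟩
  have hV := hK.heatSolution ρ hρcont hρc hρs
  set V : ℝ → EuclideanSpace ℝ (Fin n) → ℝ :=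
    fun t x => if t = 0 then ρ x else ∫ y in Ω, K t x y * ρ y with hVdef
  obtain ⟨M, hM⟩ := hV.bounded
  have key := heat_max_principle (u := fun t => V t - v (t + s)) (M := M) hΩ ?_ ?_ ?_ ?_ ?_ ?_
    τ hτ.le x hx
  · rw [Pi.sub_apply, hvs _ (by positivity)] at key
    simp only [hVdef, hτ.ne', if_false] at key
    linarith
  · intro z hz
    simp only [Pi.sub_apply, zero_add, hV.initial z hz, hρv]
    nlinarith [(hχ1 z).2, hv0 s hs z hz]
  · intro t ht z hz
    simp [hV.boundary t ht z hz, hv.boundary (t + s) (by positivity) z hz]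
  · exact fun t ht => (hV.contDiffOn t ht).sub (hv.contDiffOn (t + s) (by positivity))
  · intro t ht z hz
    have hn := hΩ.mem_nhds hz
    have hts : 0 < t + s := by positivity
    rw [((hV.contDiffOn t ht).contDiffAt hn).laplacian_sub ((hv.contDiffOn _ hts).contDiffAt hn)]
    exact (hV.heat_eq t ht z hz).sub ((hv.heat_eq _ hts z hz).comp_add_const t s)
  · refine hV.continuousOn.sub (hv.continuousOn.comp
      (f := fun p : ℝ × EuclideanSpace ℝ (Fin n) => (p.1 + s, p.2)) (by fun_prop) fun p hp => ?_)
    have : 0 ≤ p.1 := hp.1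
    exact ⟨by simpa using (by positivity : 0 ≤ p.1 + s), hp.2⟩
  · intro t ht z hz
    have h1 := (abs_le.mp (hM t ht z hz)).2
    have h2 : 0 ≤ v (t + s) z := hv0 _ (by
      have : 0 ≤ t := ht
      positivity) z hz
    simp only [Pi.sub_apply]
    linarith

theorem exists_monotone_compact_iUnion_eq (hΩ : IsOpen Ω) :
    ∃ F : ℕ → Set (EuclideanSpace ℝ (Fin n)), (∀ k, IsCompact (F k)) ∧ Monotone F ∧
      ⋃ k, F k = Ω := by
  obtain ⟨F, hFc, -, hFU, hFm⟩ := hΩ.exists_iUnion_isClosed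
  refine ⟨fun k => Metric.closedBall 0 k ∩ F k, fun k => (isCompact_closedBall _ _).inter_right
    (hFc k), fun i j hij => inter_subset_inter
    (Metric.closedBall_subset_closedBall (by exact_mod_cast hij)) (hFm hij), ?_⟩
  rw [← hFU, iUnion_inter_of_monotone (fun i j hij =>
    Metric.closedBall_subset_closedBall (by exact_mod_cast hij)) hFm, Metric.iUnion_closedBall_nat,
    univ_inter]

/-- The cutoff is removed by exhausting `Ω` with compact sets: on each of them some cutoff equals
`1`, the rest of the integrand is nonnegative, and the bound does not depend on the compact set. -/
theorem IsDirichletHeatKernel.lintegral_mul_integral_le (hK : IsDirichletHeatKernel Ω K)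
    (hΩ : IsOpen Ω) {φ : EuclideanSpace ℝ (Fin n) → ℝ} (hφ : Continuous φ)
    (hφc : HasCompactSupport φ) (hφs : tsupport φ ⊆ Ω) (hφ0 : ∀ z, 0 ≤ φ z)
    {s τ : ℝ} (hs : 0 < s) (hτ : 0 < τ) {x : EuclideanSpace ℝ (Fin n)} (hx : x ∈ closure Ω) :
    ∫⁻ z in Ω, ENNReal.ofReal (K τ x z) * ENNReal.ofReal (∫ y in Ω, K s z y * φ y) ≤
      ENNReal.ofReal (∫ y in Ω, K (τ + s) x y * φ y) := by
  obtain ⟨F, hFc, hFm, hFU⟩ := exists_monotone_compact_iUnion_eq hΩ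
  nth_rw 1 [← hFU]
  rw [setLIntegral_iUnion_of_directed _ hFm.directed_le]
  refine iSup_le fun k => ?_
  have hFΩ : F k ⊆ Ω := hFU ▸ subset_iUnion F k
  obtain ⟨χ, hχ, hχc, hχs, hχI, hχ1⟩ := exists_cutoff hΩ (hFc k) hFΩ
  obtain ⟨hint, hle⟩ := hK.integral_cutoff_le hΩ hφ hφc hφs hφ0 hχ hχc hχs hχI hs hτ hx
  refine le_trans ?_ (ENNReal.ofReal_le_ofReal hle)
  rw [ofReal_integral_eq_lintegral_ofReal hint (ae_restrict_of_forall_mem hΩ.measurableSet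
    fun z hz => mul_nonneg (hK.nonneg τ hτ x hx z hz) (mul_nonneg (hχI z).1
      (hK.integral_mul_nonneg hΩ hs (subset_closure hz) hφ0)))]
  refine le_trans (setLIntegral_mono' (hFc k).measurableSet fun z hz => ?_)
    (lintegral_mono_set hFΩ)
  rw [hχ1 z hz, one_mul, ENNReal.ofReal_mul (hK.nonneg τ hτ x hx z (hFΩ hz))]

/-- One half of the Chapman–Kolmogorov identity. -/
theorem IsDirichletHeatKernel.lintegral_kernel_mul_kernel_le (hK : IsDirichletHeatKernel Ω K)
    (hΩ : IsOpen Ω) {s τ : ℝ} (hs : 0 < s) (hτ : 0 < τ) {x y : EuclideanSpace ℝ (Fin n)}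
    (hx : x ∈ closure Ω) (hy : y ∈ Ω) :
    ∫⁻ z in Ω, ENNReal.ofReal (K τ x z) * ENNReal.ofReal (K s z y) ≤
      ENNReal.ofReal (K (τ + s) x y) := by
  obtain ⟨b, -, hbΩ, hb⟩ := exists_bump_tendsto hΩ hy
  have hbs : ∀ k, tsupport ((b k).normed volume) ⊆ Ω := fun k => by
    rw [(b k).tsupport_normed_eq]
    exact hbΩ k
  have hlim : ∀ t > 0, ∀ z ∈ closure Ω,
      Tendsto (fun k => ENNReal.ofReal (∫ y' in Ω, K t z y' * (b k).normed volume y')) atTop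
        (𝓝 (ENNReal.ofReal (K t z y))) := fun t ht z hz =>
    (ENNReal.continuous_ofReal.tendsto _).comp (hb _ (hK.continuousOn_right ht hz))
  -- The bumps `b k` approximate a point mass at `y`. Convergence inside the `z`-integral is only
  -- pointwise, and Fatou's lemma suffices for the inequality.
  calc ∫⁻ z in Ω, ENNReal.ofReal (K τ x z) * ENNReal.ofReal (K s z y)
      = ∫⁻ z in Ω, liminf (fun k => ENNReal.ofReal (K τ x z) *
          ENNReal.ofReal (∫ y' in Ω, K s z y' * (b k).normed volume y')) atTop := by
        refine setLIntegral_congr_fun hΩ.measurableSet fun z hz => ?_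
        exact (ENNReal.Tendsto.const_mul (hlim s hs z (subset_closure hz))
          (Or.inr ENNReal.ofReal_ne_top)).liminf_eq.symm
    _ ≤ liminf (fun k => ∫⁻ z in Ω, ENNReal.ofReal (K τ x z) *
          ENNReal.ofReal (∫ y' in Ω, K s z y' * (b k).normed volume y')) atTop := by
        refine lintegral_liminf_le' fun k => ?_
        have h1 : AEMeasurable (K τ x) (volume.restrict Ω) :=
          (hK.continuousOn_right hτ hx).aemeasurable hΩ.measurableSet
        have h2 : ContinuousOn (fun z => ∫ y' in Ω, K s z y' * (b k).normed volume y') Ω := by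
          have := ((hK.heatSolution _ (b k).continuous_normed (b k).hasCompactSupport_normed
            (hbs k)).contDiffOn s hs).continuousOn
          simpa [hs.ne'] using this
        exact h1.ennreal_ofReal.mul (h2.aemeasurable hΩ.measurableSet).ennreal_ofReal
    _ ≤ liminf (fun k => ENNReal.ofReal
          (∫ y' in Ω, K (τ + s) x y' * (b k).normed volume y')) atTop :=
        liminf_le_liminf (Eventually.of_forall fun k =>
          hK.lintegral_mul_integral_le hΩ (b k).continuous_normed (b k).hasCompactSupport_normed
            (hbs k) (fun z => (b k).nonneg_normed z) hs hτ hx)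
    _ = ENNReal.ofReal (K (τ + s) x y) := (hlim _ (by positivity) x hx).liminf_eq

/-- `S(τ) S(s) ≤ S(τ + s)` on nonnegative measurable functions. -/
theorem IsDirichletHeatKernel.heatSemigroup_heatSemigroup_le (hK : IsDirichletHeatKernel Ω K)
    (hΩ : IsOpen Ω) {φ : EuclideanSpace ℝ (Fin n) → ℝ≥0∞}
    (hφ : AEMeasurable φ (volume.restrict Ω)) {s τ : ℝ} (hs : 0 < s) (hτ : 0 < τ)
    {x : EuclideanSpace ℝ (Fin n)} (hx : x ∈ closure Ω) :
    heatSemigroup Ω K τ (heatSemigroup Ω K s φ) x ≤ heatSemigroup Ω K (τ + s) φ x := by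
  have hτs : 0 < τ + s := by positivity
  simp only [heatSemigroup, hs.ne', hτ.ne', hτs.ne', if_false]
  have hm1 : AEMeasurable (fun p : EuclideanSpace ℝ (Fin n) × EuclideanSpace ℝ (Fin n) =>
      ENNReal.ofReal (K τ x p.1)) ((volume.restrict Ω).prod (volume.restrict Ω)) :=
    ((hK.continuousOn_right hτ hx).aemeasurable hΩ.measurableSet).ennreal_ofReal.comp_fst
  have hm2 : AEMeasurable (fun p : EuclideanSpace ℝ (Fin n) × EuclideanSpace ℝ (Fin n) =>
      ENNReal.ofReal (K s p.1 p.2)) ((volume.restrict Ω).prod (volume.restrict Ω)) := by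
    rw [Measure.prod_restrict]
    exact (((hK.continuousOn_spatial hs).mono (prod_mono subset_closure le_rfl)).aemeasurable
      (hΩ.measurableSet.prod hΩ.measurableSet)).ennreal_ofReal
  calc ∫⁻ z in Ω, ENNReal.ofReal (K τ x z) * ∫⁻ y in Ω, ENNReal.ofReal (K s z y) * φ y
      = ∫⁻ z in Ω, ∫⁻ y in Ω, ENNReal.ofReal (K τ x z) * (ENNReal.ofReal (K s z y) * φ y) := by
        simp_rw [lintegral_const_mul' _ _ ENNReal.ofReal_ne_top]
    _ = ∫⁻ y in Ω, ∫⁻ z in Ω, ENNReal.ofReal (K τ x z) * (ENNReal.ofReal (K s z y) * φ y) :=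
        lintegral_lintegral_swap (hm1.mul (hm2.mul hφ.comp_snd))
    _ = ∫⁻ y in Ω, (∫⁻ z in Ω, ENNReal.ofReal (K τ x z) * ENNReal.ofReal (K s z y)) * φ y := by
        refine setLIntegral_congr_fun hΩ.measurableSet fun y hy => ?_
        simp only [← mul_assoc]
        have h1 : ContinuousOn (fun z => K s z y) Ω :=
          (hK.continuousOn_spatial hs).comp (f := fun z => (z, y)) (by fun_prop)
            fun z hz => ⟨subset_closure hz, hy⟩
        have h2 : AEMeasurable (fun z => ENNReal.ofReal (K τ x z)) (volume.restrict Ω) :=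
          ((hK.continuousOn_right hτ hx).aemeasurable hΩ.measurableSet).ennreal_ofReal
        exact lintegral_mul_const'' _ (h2.mul (h1.aemeasurable hΩ.measurableSet).ennreal_ofReal)
    _ ≤ ∫⁻ y in Ω, ENNReal.ofReal (K (τ + s) x y) * φ y :=
        setLIntegral_mono' hΩ.measurableSet fun y hy => by
          gcongr
          exact hK.lintegral_kernel_mul_kernel_le hΩ hs hτ hx hy

/-- The heat flow of an integrable function is finite for positive times. -/
theorem IsDirichletHeatKernel.heatSemigroup_ne_top (hK : IsDirichletHeatKernel Ω K)
    (hΩ : IsOpen Ω) {φ : EuclideanSpace ℝ (Fin n) → ℝ} (hφ : IntegrableOn φ Ω) {t : ℝ}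
    (ht : 0 < t) {x : EuclideanSpace ℝ (Fin n)} (hx : x ∈ closure Ω) :
    heatSemigroup Ω K t (fun y => ENNReal.ofReal (φ y)) x ≠ ∞ := by
  obtain ⟨B, hB⟩ := hK.exists_bound hΩ ht
  simp only [heatSemigroup, ht.ne', if_false]
  refine ne_top_of_le_ne_top (ENNReal.mul_ne_top (ENNReal.ofReal_ne_top (r := B))
    hφ.lintegral_lt_top.ne) ?_
  rw [← lintegral_const_mul' _ _ ENNReal.ofReal_ne_top]
  refine setLIntegral_mono' hΩ.measurableSet fun y hy => ?_
  gcongr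
  exact hB x hx y hy

/-- The heat flow is jointly measurable on `(0, ∞) × Ω`. -/
theorem IsDirichletHeatKernel.exists_measurable_heatSemigroup (hK : IsDirichletHeatKernel Ω K)
    (hΩ : IsOpen Ω) {φ : EuclideanSpace ℝ (Fin n) → ℝ≥0∞}
    (hφ : AEMeasurable φ (volume.restrict Ω)) :
    ∃ S : ℝ × EuclideanSpace ℝ (Fin n) → ℝ≥0∞, Measurable S ∧
      ∀ t > 0, ∀ x ∈ Ω, S (t, x) = heatSemigroup Ω K t φ x := by
  classical
  let D : Set (ℝ × EuclideanSpace ℝ (Fin n) × EuclideanSpace ℝ (Fin n)) :=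
    Ioi 0 ×ˢ closure Ω ×ˢ Ω
  have hD : MeasurableSet D :=
    measurableSet_Ioi.prod (isClosed_closure.measurableSet.prod hΩ.measurableSet)
  -- Nothing is known about `K` off `D`; extension by zero yields a Borel function to which Tonelli
  -- measurability applies.
  let k := D.piecewise (fun p => K p.1 p.2.1 p.2.2) 0
  have hk : Measurable k := hK.continuousOn.measurable_piecewise continuousOn_const hD
  refine ⟨fun p => ∫⁻ y in Ω, ENNReal.ofReal (k (p.1, p.2, y)) * hφ.mk φ y, ?_, ?_⟩
  · refine Measurable.lintegral_prod_right' (f := fun q : (ℝ × EuclideanSpace ℝ (Fin n)) ×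
      EuclideanSpace ℝ (Fin n) => ENNReal.ofReal (k (q.1.1, q.1.2, q.2)) * hφ.mk φ q.2) ?_
    exact (hk.comp (by fun_prop)).ennreal_ofReal.mul (hφ.measurable_mk.comp measurable_snd)
  · intro t ht x hx
    simp only [heatSemigroup, ht.ne', if_false]
    refine lintegral_congr_ae ?_
    filter_upwards [hφ.ae_eq_mk, ae_restrict_mem hΩ.measurableSet] with y hy hyΩ
    have : (t, x, y) ∈ D := ⟨ht, subset_closure hx, hyΩ⟩
    rw [hy, show k (t, x, y) = K t x y from piecewise_eq_of_mem _ _ _ this]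

end semigroup

/-! ### The supersolution -/

theorem measurableSet_spaceTime {n : ℕ} {Ω : Set (EuclideanSpace ℝ (Fin n))} (hΩ : IsOpen Ω)
    (T : EReal) : MeasurableSet (spaceTime Ω T) := by
  have h1 : MeasurableSet {t : ℝ | (t : EReal) < T} := measurable_coe_real_ereal measurableSet_Iio
  exact (measurable_fst measurableSet_Ioi).inter
    ((measurable_fst h1).inter (measurable_snd hΩ.measurableSet))

/-- The arithmetic core of the condition on `A`: if `p ≤ q`, `r / q ≤ E` and `1 + E * H ≤ A`,
then `p + r * H ≤ A * q`. -/
theorem ENNReal.add_mul_le_of_div_le {p q r E H A : ℝ≥0∞} (hq : q ≠ ∞) (hA : A ≠ ∞)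
    (hpq : p ≤ q) (hr : r / q ≤ E) (hEH : 1 + E * H ≤ A) : p + r * H ≤ A * q := by
  have hEHt : E * H ≠ ∞ := ne_top_of_le_ne_top hA (le_add_self.trans hEH)
  have key : r * H ≤ E * H * q := by
    -- `E = ∞` is compatible with the hypothesis only through `∞ * 0 = 0`. Otherwise `E` is finite,
    -- and `r / q ≤ E` forces `r = 0` wherever `q = 0`.
    rcases eq_or_ne H 0 with rfl | hH
    · simp
    have hE : E ≠ ∞ := fun h => hEHt (by rw [h, ENNReal.top_mul hH])
    have hrq : r ≤ E * q :=
      (ENNReal.div_le_iff_le_mul (Or.inr hE) (Or.inl hq)).mp hr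
    calc r * H ≤ E * q * H := by gcongr
      _ = E * H * q := by ring
  calc p + r * H ≤ q + E * H * q := add_le_add hpq key
    _ = (1 + E * H) * q := by ring
    _ ≤ A * q := by gcongr

theorem mainTheorem3 {n : ℕ} (Ω : Set (EuclideanSpace ℝ (Fin n))) (hΩ : IsOpen Ω)
    -- the heat kernel of `Ω`
    (K : ℝ → EuclideanSpace ℝ (Fin n) → EuclideanSpace ℝ (Fin n) → ℝ)
    (hK : IsDirichletHeatKernel Ω K)
    -- the source term
    (f : ℝ≥0 → ℝ≥0) (hf : Continuous f) (hf_mono : Monotone f)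
    -- `φ, ψ ∈ L¹₊(Ω)`
    (φ ψ : EuclideanSpace ℝ (Fin n) → ℝ)
    (hφ : IntegrableOn φ Ω) (hφ_nonneg : ∀ᵐ x ∂(volume.restrict Ω), 0 ≤ φ x)
    (hψ : IntegrableOn ψ Ω) (hψ_nonneg : ∀ᵐ x ∂(volume.restrict Ω), 0 ≤ ψ x)
    -- the linear heat flows `S(t) φ` and `S(t) ψ`
    (Sφ Sψ : ℝ → EuclideanSpace ℝ (Fin n) → ℝ≥0∞)
    (hSφ : Sφ = fun t => heatSemigroup Ω K t (fun y => ENNReal.ofReal (φ y)))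
    (hSψ : Sψ = fun t => heatSemigroup Ω K t (fun y => ENNReal.ofReal (ψ y)))
    (A : ℝ≥0) (hA : 1 < A) (T : EReal) (hT : 0 < T)
    (g : ℝ≥0 → ℝ≥0) (h : ℝ → ℝ≥0)
    (hh : ∀ t : ℝ, 0 < t → (t : EReal) ≤ T →
      (h t : ℝ≥0∞) =
        essSup (fun x => (f (A * g (Sψ t x).toNNReal) : ℝ≥0∞) / Sψ t x) (volume.restrict Ω))
    (hle : ∀ t : ℝ, 0 < t → (t : EReal) ≤ T →
      ∀ᵐ x ∂(volume.restrict Ω), Sφ t x ≤ g (Sψ t x).toNNReal)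
    (hcond : ∀ t : ℝ, 0 < t → (t : EReal) ≤ T →
      1 + essSup (fun x => Sψ t x / (g (Sψ t x).toNNReal : ℝ≥0∞)) (volume.restrict Ω) *
        ∫⁻ s in Ioo 0 t, (h s : ℝ≥0∞) ≤ A)
    (w : ℝ → EuclideanSpace ℝ (Fin n) → ℝ≥0∞)
    (hw : w = fun t x => Sφ t x + Sψ t x * ∫⁻ s in Ioo 0 t, (h s : ℝ≥0∞)) :
    IsSupersolution Ω K f (fun y => ENNReal.ofReal (φ y)) T w ∧
      ∀ t : ℝ, 0 ≤ t → (t : EReal) ≤ T → ∀ᵐ x ∂(volume.restrict Ω),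
        variationOfConstants Ω K f (fun y => ENNReal.ofReal (φ y)) w t x ≤ w t x := by
  have hφm : AEMeasurable (fun y => ENNReal.ofReal (φ y)) (volume.restrict Ω) :=
    hφ.aemeasurable.ennreal_ofReal
  have hψm : AEMeasurable (fun y => ENNReal.ofReal (ψ y)) (volume.restrict Ω) :=
    hψ.aemeasurable.ennreal_ofReal
  have hSψ_top : ∀ t > 0, ∀ x ∈ Ω, Sψ t x ≠ ∞ := fun t ht x hx => by
    rw [hSψ]
    exact hK.heatSemigroup_ne_top hΩ hψ ht (subset_closure hx)
  have hwA : ∀ t : ℝ, 0 < t → (t : EReal) ≤ T → ∀ᵐ x ∂(volume.restrict Ω),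
      w t x ≤ (A * g (Sψ t x).toNNReal : ℝ≥0) := by
    intro t ht htT
    filter_upwards [hle t ht htT, ENNReal.ae_le_essSup (μ := volume.restrict Ω)
      fun x => Sψ t x / (g (Sψ t x).toNNReal : ℝ≥0∞)] with x h1 h2
    rw [hw, ENNReal.coe_mul]
    exact ENNReal.add_mul_le_of_div_le ENNReal.coe_ne_top ENNReal.coe_ne_top h1 h2
      (hcond t ht htT)
  have hfw : ∀ t : ℝ, 0 < t → (t : EReal) ≤ T → ∀ᵐ x ∂(volume.restrict Ω),
      (f (w t x).toNNReal : ℝ≥0∞) ≤ h t * Sψ t x := by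
    intro t ht htT
    filter_upwards [hwA t ht htT, ENNReal.ae_le_essSup (μ := volume.restrict Ω)
      fun x => (f (A * g (Sψ t x).toNNReal) : ℝ≥0∞) / Sψ t x,
      ae_restrict_mem hΩ.measurableSet] with x h1 h2 hx
    -- Both degenerate quotients matter: where `S(t)ψ = 0`, finiteness of `h t` forces the numerator
    -- to vanish, and finiteness of `S(t)ψ` rules out `a / ∞ = 0`.
    rw [← hh t ht htT, ENNReal.div_le_iff_le_mul (Or.inr ENNReal.coe_ne_top)
      (Or.inl (hSψ_top t ht x hx))] at h2
    have h3 := ENNReal.toNNReal_mono ENNReal.coe_ne_top h1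
    rw [ENNReal.toNNReal_coe] at h3
    exact (ENNReal.coe_le_coe.mpr (hf_mono h3)).trans h2
  -- The bound on `f(w(s))` holds only a.e., but `S(t - s)` with `s < t` integrates it against the
  -- kernel, so the conclusion holds at every point of `Ω`.
  have hmain : ∀ t : ℝ, 0 < t → (t : EReal) ≤ T → ∀ x ∈ Ω,
      variationOfConstants Ω K f (fun y => ENNReal.ofReal (φ y)) w t x ≤ w t x := by
    intro t ht htT x hx
    have hstep : ∀ s ∈ Ioo 0 t, heatSemigroup Ω K (t - s)
        (fun y => (f (w s y).toNNReal : ℝ≥0∞)) x ≤ Sψ t x * h s := by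
      intro s hs
      have hts : 0 < t - s := sub_pos.mpr hs.2
      have hsT : (s : EReal) ≤ T := le_trans (EReal.coe_le_coe_iff.mpr hs.2.le) htT
      calc heatSemigroup Ω K (t - s) (fun y => (f (w s y).toNNReal : ℝ≥0∞)) x
          ≤ heatSemigroup Ω K (t - s) (fun y => h s * Sψ s y) x := by
            simp only [heatSemigroup, hts.ne', if_false]
            refine lintegral_mono_ae ?_
            filter_upwards [hfw s hs.1 hsT] with y hy
            gcongr
        _ = h s * heatSemigroup Ω K (t - s) (Sψ s) x := by
            simp only [heatSemigroup, hts.ne', if_false]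
            rw [← lintegral_const_mul' _ _ ENNReal.coe_ne_top]
            simp only [mul_left_comm]
        _ ≤ h s * Sψ t x := by
            gcongr
            have := hK.heatSemigroup_heatSemigroup_le hΩ hψm hs.1 hts (subset_closure hx)
            rw [sub_add_cancel] at this
            rw [hSψ]
            exact this
        _ = Sψ t x * h s := mul_comm _ _
    have hwt : w t x = heatSemigroup Ω K t (fun y => ENNReal.ofReal (φ y)) x +
        Sψ t x * ∫⁻ s in Ioo 0 t, (h s : ℝ≥0∞) := by rw [hw, hSφ]
    -- Finiteness of `S(t)ψ` lets it move inside the integral without measurability of `h`, which is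
    -- not assumed.
    rw [variationOfConstants, hwt, ← lintegral_const_mul' _ _ (hSψ_top t ht x hx)]
    exact add_le_add le_rfl (setLIntegral_mono' measurableSet_Ioo hstep)
  obtain ⟨U, hU, hUφ⟩ := hK.exists_measurable_heatSemigroup hΩ hφm
  obtain ⟨V, hV, hVψ⟩ := hK.exists_measurable_heatSemigroup hΩ hψm
  -- Monotonicity in `t` gives measurability whether or not `h` is measurable.
  have hH : Measurable fun t : ℝ => ∫⁻ s in Ioo 0 t, (h s : ℝ≥0∞) :=
    Monotone.measurable fun a b hab => lintegral_mono_set (Ioo_subset_Ioo_right hab)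
  let W : ℝ × EuclideanSpace ℝ (Fin n) → ℝ≥0∞ :=
    fun p => U p + V p * ∫⁻ s in Ioo 0 p.1, (h s : ℝ≥0∞)
  have hW : Measurable W := hU.add (hV.mul (hH.comp measurable_fst))
  have hWw : ∀ t > 0, ∀ x ∈ Ω, W (t, x) = w t x := fun t ht x hx => by
    simp only [W, hw, hSφ, hSψ, hUφ t ht x hx, hVψ t ht x hx]
  have hmeas := measurableSet_spaceTime hΩ T
  refine ⟨⟨⟨W, hW, ?_⟩, ?_, ?_⟩, ?_⟩
  · refine ae_restrict_of_forall_mem hmeas fun p hp => ?_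
    exact (hWw p.1 hp.1 p.2 hp.2.2).symm
  · rw [ae_restrict_iff' hmeas]
    -- Finiteness of `w(t)` is known a.e. in `Ω` for each fixed `t`. Passing to a.e. in space-time
    -- by Tonelli needs a measurable set, which the measurable version `W` supplies.
    have hset : MeasurableSet {p | p ∈ spaceTime Ω T → W p ≠ ∞} :=
      hmeas.imp (hW (measurableSet_singleton ∞).compl)
    have hae : ∀ᵐ p : ℝ × EuclideanSpace ℝ (Fin n), p ∈ spaceTime Ω T → W p ≠ ∞ := by
      rw [Measure.volume_eq_prod, Measure.ae_prod_iff_ae_ae hset]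
      refine Eventually.of_forall fun t => ?_
      by_cases ht : 0 < t ∧ (t : EReal) < T
      · have := hwA t ht.1 ht.2.le
        rw [ae_restrict_iff' hΩ.measurableSet] at this
        filter_upwards [this] with x hx hp
        rw [hWw t ht.1 x hp.2.2]
        exact ne_top_of_le_ne_top ENNReal.coe_ne_top (hx hp.2.2)
      · exact Eventually.of_forall fun x hp => absurd ⟨hp.1, hp.2.1⟩ ht
    filter_upwards [hae] with p hp hpT
    rw [← hWw p.1 hpT.1 p.2 hpT.2.2]
    exact hp hpT
  · exact ae_restrict_of_forall_mem hmeas fun p hp => hmain p.1 hp.1 hp.2.1.le p.2 hp.2.2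
  · intro t ht htT
    rcases ht.eq_or_lt with rfl | ht
    · refine Eventually.of_forall fun x => ?_
      simp [variationOfConstants, hw, hSφ]
    · exact ae_restrict_of_forall_mem hΩ.measurableSet (hmain t ht htT)
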